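/- An idempotent semiring $\mathcal S=(D,\oplus,\otimes,\bar 0,\bar 1)$ is ordered by $a\sqsubseteq b :\Leftrightarrow a\oplus b=a$; vectors over $D$ are ordered componentwise. Assume that $\sqsubseteq$ is total and that extend preserves inequality: for $a,b,c\in D\setminus\{\bar 0\}$ with $a\neq b$ we have $a\otimes c\neq b\otimes c$ and $c\otimes a\neq c\otimes b$. For an equation system $x=f(x)$ over $D$, a greatest fixed point is a fixed point $v$ with $v'\sqsubseteq v$ for all fixed points $v'$; the Kleene sequence is $\kappa^{(0)}=(\bar 0,\bar 0,\dots)$, $\kappa^{(k+1)}=f(\kappa^{(k)})$; and a component $i$ is a witness component if $\{\kappa^{(k)}_i\mid k\ge 0\}$ is infinite. Safe Kleene iteration on a system with $n$ variables computes $\kappa^{(0)},\dots,\kappa^{(n+1)}$; if $\kappa^{(n+1)}_i\neq\kappa^{(n)}_i$ for some $i$, it returns some (any) such $i$, and otherwise it returns the vector $\kappa^{(n)}$. Consider a weighted pushdown system with finite sets $P$ of control states and $\Gamma$ of stack symbols, and a finite set $\Delta$ of rules $r=(pX\xrightarrow{d_r}q\alpha)$, where $p,q\in P$, $X\in\Gamma$,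 $\alpha\in\Gamma^*$, $|\alpha|\le 2$ and $d_r\in D$. A configuration is $p\gamma$ with $p\in P$, $\gamma\in\Gamma^*$; the rule $r$ gives the moves $pX\gamma\xrightarrow{r}q\alpha\gamma$ for all $\gamma\in\Gamma^*$. The weight of a path using the rules $r_1,\dots,r_m$ is $d_{r_1}\otimes\cdots\otimes d_{r_m}$ ($\bar 1$ if $m=0$). Fix a target configuration $c_f=p_f\varepsilon$ with $p_f\in P$. Let (1) be the infinite system with one variable $[c]$ for each configuration $c$, $$[c]=I(c)\oplus\bigoplus_{c\xrightarrow{r}c'}\bigl(d_r\otimes[c']\bigr),\qquad I(c_f)=\bar 1,\quad I(c)=\bar 0\text{ for }c\ne c_f,$$ and let (2) be the finite system with one variable $[pXq]$ for each $(p,X,q)\in P\times\Gamma\times P$, $$[pXq]=\bigoplus_{(pX\xrightarrow{d}q\varepsilon)\in\Delta}d\ \oplus\bigoplus_{(pX\xrightarrow{d}rY)\in\Delta}\bigl(d\otimes[rYq]\bigr)\ \oplus\bigoplus_{(pX\xrightarrow{d}rYZ)\in\Delta}\Bigl(d\otimes\bigoplus_{s\in P}\bigl([rYs]\otimes[sZq]\bigr)\Bigr).$$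 Then every answer of safe Kleene iteration on (2) is correct in the following sense (and it always returns an answer): either it returns a component, and that component is a witness component of (2); or it returns a vector $\lambda$, and then $\lambda$ is the greatest fixed point of (2), and the vector $\mu$ given by $$\mu_{[c]}=\bigoplus_{\substack{p_0,\dots,p_m\in P\\ p_0=p,\ p_m=p_f}}\bigl(\lambda_{[p_0X_1p_1]}\otimes\cdots\otimes\lambda_{[p_{m-1}X_mp_m]}\bigr)\qquad\text{for }c=pX_1\dots X_m\tag{3}$$ is the greatest fixed point of (1); moreover $\mu_{[c]}$ is, for every configuration $c$, the infimum with respect to $\sqsubseteq$ of the weights of all paths from $c$ to $c_f$ (the meet over all paths). -/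

import Mathlib

namespace WPDS

/-! ### Ordering, fixed points and Kleene sequences over an idempotent semiring -/

section Semiring

variable {D : Type*} [IdemSemiring D]

/-- The ordering `a ⊑ b` of an idempotent semiring: `a ⊕ b = a`. Combine is `+`, extend is `*`.
(This is the converse of Mathlib's order on an `IdemSemiring`; `0` is the largest element.) -/
def Below (a b : D) : Prop := a + b = a

/-- Componentwise extension of `Below` to vectors. -/
def VecBelow {ι : Type*} (u v : ι → D) : Prop := ∀ i, Below (u i) (v i)

variable (D) in
/-- The ordering of the semiring is total. -/
def IsTotallyOrdered : Prop := ∀ a b : D, Below a b ∨ Below b a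

variable (D) in
/-- Extend preserves inequality: multiplying two different nonzero elements, on either side, by
the same nonzero element gives two different elements. -/
def ExtendPreservesInequality : Prop :=
  ∀ a b c : D, a ≠ 0 → b ≠ 0 → c ≠ 0 → a ≠ b → a * c ≠ b * c ∧ c * a ≠ c * b

/-- `v` is the greatest fixed point of the equation system `x = f x`. -/
def IsGreatestFixedPoint {ι : Type*} (f : (ι → D) → (ι → D)) (v : ι → D) : Prop :=
  f v = v ∧ ∀ v' : ι → D, f v' = v' → VecBelow v' v

/-- The Kleene sequence: it starts in the all-`0` vector and applies `f` in each step. -/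
def kleene {ι : Type*} (f : (ι → D) → (ι → D)) : ℕ → ι → D
  | 0 => fun _ => 0
  | k + 1 => f (kleene f k)

/-- Component `i` is a witness component: its Kleene sequence takes infinitely many values. -/
def IsWitnessComponent {ι : Type*} (f : (ι → D) → (ι → D)) (i : ι) : Prop :=
  (Set.range fun k : ℕ => kleene f k i).Infinite

/-- `b` is the infimum (the possibly infinite combine) of the set `A` with respect to `Below`. -/
def IsMeet (A : Set D) (b : D) : Prop :=
  (∀ a ∈ A, Below b a) ∧ ∀ b' : D, (∀ a ∈ A, Below b' a) → Below b' b

/-- The possible answers of the safe Kleene iteration. -/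
inductive Answer (ι D : Type*)
  /-- "Kleene's iteration does not terminate. Component `i` is a witness." -/
  | witness (i : ι) : Answer ι D
  /-- "The vector `v` is the greatest fixed point." -/
  | fixedPoint (v : ι → D) : Answer ι D

/-- `SafeKleene f o`: the safe Kleene iteration, run on the system `x = f x` with `n` variables,
may return the answer `o`. It computes the Kleene sequence up to index `n + 1`; if some
component differs between steps `n` and `n + 1`, it reports any one such component, otherwise it
returns step `n`. -/
inductive SafeKleene {ι : Type*} [Fintype ι] (f : (ι → D) → (ι → D)) : Answer ι D → Prop
  | witness (i : ι)
      (h : kleene f (Fintype.card ι + 1) i ≠ kleene f (Fintype.card ι) i) :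
      SafeKleene f (Answer.witness i)
  | fixedPoint
      (h : ¬ ∃ i, kleene f (Fintype.card ι + 1) i ≠ kleene f (Fintype.card ι) i) :
      SafeKleene f (Answer.fixedPoint (kleene f (Fintype.card ι)))

end Semiring

/-! ### Weighted pushdown systems -/

/-- A rule `src top ↪ dst word` of weight `weight`. -/
structure Rule (P Γ D : Type*) where
  /-- control state on the left-hand side -/
  src : P
  /-- stack symbol on the left-hand side -/
  top : Γ
  /-- weight of the rule -/
  weight : D
  /-- control state on the right-hand side -/
  dst : P
  /-- word that replaces the stack symbol -/
  word : List Γ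

/-- A weighted pushdown system with control states `P`, stack alphabet `Γ` and weights in `D`,
given by its finite set of rules. -/
structure System (P Γ D : Type*) where
  /-- the finite set of rules -/
  rules : Finset (Rule P Γ D)

/-- Configurations: a control state and a stack content, topmost symbol first. -/
abbrev Config (P Γ : Type*) := P × List Γ

section Pushdown

variable {P Γ D : Type*}

/-- One move from `c` to `c'` by the rule `r`. -/
def Move (W : System P Γ D) (c : Config P Γ) (r : Rule P Γ D) (c' : Config P Γ) : Prop :=
  r ∈ W.rules ∧ ∃ γ : List Γ, c = (r.src, r.top :: γ) ∧ c' = (r.dst, r.word ++ γ)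

/-- `Path W c σ c'`: the rule sequence `σ` leads from `c` to `c'`. -/
inductive Path (W : System P Γ D) : Config P Γ → List (Rule P Γ D) → Config P Γ → Prop
  | nil (c : Config P Γ) : Path W c [] c
  | cons {c c' c'' : Config P Γ} {r : Rule P Γ D} {σ : List (Rule P Γ D)}
      (h : Move W c r c') (hσ : Path W c' σ c'') : Path W c (r :: σ) c''

variable [IdemSemiring D]

/-- The weight of a rule sequence: the product, in order, of the weights of its rules. -/
def weight (σ : List (Rule P Γ D)) : D := (σ.map Rule.weight).prod

/-- The weights of all paths from `c` to the target configuration `(pf, ε)`. -/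
def pathWeights (W : System P Γ D) (pf : P) (c : Config P Γ) : Set D :=
  {a | ∃ σ, Path W c σ (pf, []) ∧ weight σ = a}

variable [DecidableEq P] [DecidableEq Γ]

/-- The infinite system with one variable `[c]` for each configuration `c`:
`[c] = I(c) ⊕ ⨁_{c ⟶ c' by r} d_r ⊗ [c']`, where `I(c)` is `1` at the target `(pf, ε)` and
`0` elsewhere. A rule `r` applies to `c` iff `c = (r.src, r.top :: γ)` for some `γ`, and then
`c' = (r.dst, r.word ++ γ)`. -/
def configSystem (W : System P Γ D) (pf : P) (v : Config P Γ → D) : Config P Γ → D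
  | (p, []) => if p = pf then 1 else 0
  | (p, X :: γ) =>
      ∑ r ∈ W.rules with r.src = p ∧ r.top = X, r.weight * v (r.dst, r.word ++ γ)

variable [Fintype P]

/-- The contribution of one rule to the right-hand side of the equation for a variable `[pXq]`
to which the rule applies. Rules whose word has more than two symbols contribute nothing. -/
def ruleTerm (v : P × Γ × P → D) (r : Rule P Γ D) (q : P) : D :=
  match r.word with
  | [] => if r.dst = q then r.weight else 0
  | [Y] => r.weight * v (r.dst, Y, q)
  | [Y, Z] => r.weight * ∑ s : P, v (r.dst, Y, s) * v (s, Z, q)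
  | _ => 0

/-- The finite "pop sequence" system with one variable `[pXq]` for each triple `(p, X, q)`. -/
def popSystem (W : System P Γ D) (v : P × Γ × P → D) : P × Γ × P → D
  | (p, X, q) => ∑ r ∈ W.rules with r.src = p ∧ r.top = X, ruleTerm v r q

/-- The vector `μ` built from a vector `l` of values of the variables `[pXq]`: for
`c = (p, X₁ … Xₙ)`, the combine over all state sequences `p = p₀, p₁, …, pₙ = pf` of the products
`l [p₀X₁p₁] ⊗ ⋯ ⊗ l [pₙ₋₁Xₙpₙ]`. -/
def combinePops (pf : P) (l : P × Γ × P → D) (c : Config P Γ) : D :=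
  ∑ s : Fin (c.2.length + 1) → P with s 0 = c.1 ∧ s (Fin.last c.2.length) = pf,
    (List.ofFn fun i : Fin c.2.length => l (s i.castSucc, c.2.get i, s i.succ)).prod

end Pushdown

end WPDS

/-! In Mathlib's order `≤`, the reverse of `Below`, greatest fixed points become least ones and
meets become suprema. Let N be the number of variables of the pop system. By totality a nonzero
finite sum equals one of its terms, so a nonzero Kleene iterate is the value of a single derivation
tree (`kleene_eq_zero_or_derivation`). A tree with no variable repeated along a branch is bounded by
iterate N (`Derivation.le_kleene_or_meets_or_pumpable`).

If component `i` changes after step N but takes finitely many values, these have a maximum M,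
strictly above iterate N. A smallest tree of value M then repeats a variable on a branch. By
minimality the repeated piece strictly increases the value of the subtree it surrounds, so inserting
it once more exceeds M (`ExtendPreservesInequality.pump_lt`), a contradiction.

If the iteration stops, distributivity turns the fixed point into a fixed point μ of the
configuration system. Every fixed point of that system bounds all path weights, and each nonzero
entry of μ is itself a path weight. Hence μ is both the least fixed point and the supremum. -/

namespace WPDS

/-! ### The reversed order and strict monotonicity of extend -/

section Order

variable {D : Type*} [IdemSemiring D]

theorem below_iff_le {a b : D} : Below a b ↔ b ≤ a :=
  add_eq_left_iff_le

theorem le_sum_of_mem {ι : Type*} {s : Finset ι} (f : ι → D) {i : ι} (hi : i ∈ s) :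
    f i ≤ ∑ j ∈ s, f j :=
  Finset.single_le_sum_of_canonicallyOrdered hi

theorem sum_le_of_forall_le {ι : Type*} {s : Finset ι} {f : ι → D} {b : D}
    (h : ∀ i ∈ s, f i ≤ b) : ∑ i ∈ s, f i ≤ b := by
  classical
  induction s using Finset.induction_on with
  | empty => simp
  | insert i s hi ih =>
    rw [Finset.sum_insert hi]
    exact add_le (h i (by simp)) (ih fun j hj => h j (by simp [hj]))

theorem IsTotallyOrdered.le_total (h : IsTotallyOrdered D) (a b : D) : a ≤ b ∨ b ≤ a := by
  simpa only [below_iff_le, or_comm] using h a b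

/-- Over a totally ordered idempotent semiring a nonzero finite sum is one of its terms. -/
theorem IsTotallyOrdered.sum_eq_zero_or_exists (h : IsTotallyOrdered D) {ι : Type*}
    (s : Finset ι) (f : ι → D) : ∑ i ∈ s, f i = 0 ∨ ∃ i ∈ s, ∑ i ∈ s, f i = f i := by
  classical
  induction s using Finset.induction_on with
  | empty => simp
  | insert i s hi ih =>
    rw [Finset.sum_insert hi]
    right
    rcases ih with ih | ⟨j, hj, ih⟩
    · exact ⟨i, by simp, by rw [ih, add_zero]⟩
    · rw [ih]
      rcases h (f i) (f j) with hij | hij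
      · exact ⟨i, by simp, hij⟩
      · exact ⟨j, by simp [hj], by rw [add_comm]; exact hij⟩

theorem ExtendPreservesInequality.mul_lt_mul_right (h : ExtendPreservesInequality D) {a b c : D}
    (ha : a ≠ 0) (hc : c ≠ 0) (hab : a < b) : a * c < b * c :=
  lt_of_le_of_ne (mul_le_mul_left hab.le c)
    (h a b c ha ((pos_iff_ne_zero.2 ha).trans hab).ne' hc hab.ne).1

theorem ExtendPreservesInequality.mul_lt_mul_left (h : ExtendPreservesInequality D) {a b c : D}
    (ha : a ≠ 0) (hc : c ≠ 0) (hab : a < b) : c * a < c * b :=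
  lt_of_le_of_ne (mul_le_mul_right hab.le c)
    (h a b c ha ((pos_iff_ne_zero.2 ha).trans hab).ne' hc hab.ne).2

/-- If inserting the factors `l'` and `r'` around `b` increases `l * b * r`, then inserting them
a second time increases it again. -/
theorem ExtendPreservesInequality.pump_lt (h : ExtendPreservesInequality D) {l l' b r' r : D}
    (hb : b < l' * b * r') (hne : l * (l' * b * r') * r ≠ 0) :
    l * (l' * b * r') * r < l * (l' * (l' * b * r') * r') * r := by
  have hb0 : b ≠ 0 := by rintro rfl; simp at hb
  have hw0 : l' * b * r' ≠ 0 := ((pos_iff_ne_zero.2 hb0).trans hb).ne'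
  have h1 := h.mul_lt_mul_left hb0 (left_ne_zero_of_mul (left_ne_zero_of_mul hw0)) hb
  have h2 := h.mul_lt_mul_right (left_ne_zero_of_mul hw0) (right_ne_zero_of_mul hw0) h1
  have hl := left_ne_zero_of_mul hne
  have h3 := h.mul_lt_mul_left hw0 (left_ne_zero_of_mul hl) h2
  exact h.mul_lt_mul_right hl (right_ne_zero_of_mul hne) h3

/-! ### Kleene sequences of monotone maps -/

section Kleene

variable {ι : Type*} {f : (ι → D) → ι → D}

theorem kleene_mono (hf : Monotone f) : Monotone (kleene f) := by
  refine monotone_nat_of_le_succ fun k => ?_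
  induction k with
  | zero => exact fun i => zero_le
  | succ k ih => exact hf ih

theorem kleene_le_of_fixed (hf : Monotone f) {v : ι → D} (hv : f v = v) (k : ℕ) :
    kleene f k ≤ v := by
  induction k with
  | zero => exact fun i => zero_le
  | succ k ih => exact (hf ih).trans_eq hv

/-- A component with finitely many Kleene iterates attains an upper bound of all of them. -/
theorem exists_forall_kleene_le (hf : Monotone f) {i : ι} (hi : ¬ IsWitnessComponent f i) :
    ∃ K, ∀ k, kleene f k i ≤ kleene f K i := by
  have hfin : (Set.range fun k => kleene f k i).Finite := Set.not_infinite.1 hi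
  obtain ⟨_, ⟨K, rfl⟩, hK⟩ := hfin.exists_maximal (Set.range_nonempty _)
  refine ⟨K, fun k => ?_⟩
  exact (kleene_mono hf (le_max_left k K) i).trans
    (hK ⟨max k K, rfl⟩ (kleene_mono hf (le_max_right k K) i))

end Kleene

end Order

/-! ### Derivation trees and pumping -/

section PopSystem

variable {P Γ D : Type*} [IdemSemiring D]

/-- `Derivation W x n a`: there is a derivation tree for the variable `x` of the pop system with
`n` nodes and value `a`. -/
inductive Derivation (W : System P Γ D) : P × Γ × P → ℕ → D → Prop
  | leaf {r : Rule P Γ D} (hr : r ∈ W.rules) (hw : r.word = []) :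
      Derivation W (r.src, r.top, r.dst) 1 r.weight
  | unary {r : Rule P Γ D} {Y : Γ} {q : P} {n : ℕ} {a : D} (hr : r ∈ W.rules) (hw : r.word = [Y])
      (h : Derivation W (r.dst, Y, q) n a) :
      Derivation W (r.src, r.top, q) (n + 1) (r.weight * a)
  | binary {r : Rule P Γ D} {Y Z : Γ} {s q : P} {n m : ℕ} {a b : D} (hr : r ∈ W.rules)
      (hw : r.word = [Y, Z]) (h₁ : Derivation W (r.dst, Y, s) n a)
      (h₂ : Derivation W (s, Z, q) m b) :
      Derivation W (r.src, r.top, q) (n + m + 1) (r.weight * (a * b))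

/-- `Context W x y l r n`: there is a derivation tree for `x` with one subtree for `y` removed; it
has `n` nodes, and `l` and `r` are the values to the left and to the right of the gap. -/
inductive Context (W : System P Γ D) : P × Γ × P → P × Γ × P → D → D → ℕ → Prop
  | refl (x : P × Γ × P) : Context W x x 1 1 0
  | unary {ρ : Rule P Γ D} {Y : Γ} {q : P} {y : P × Γ × P} {l r : D} {n : ℕ} (hr : ρ ∈ W.rules)
      (hw : ρ.word = [Y]) (h : Context W (ρ.dst, Y, q) y l r n) :
      Context W (ρ.src, ρ.top, q) y (ρ.weight * l) r (n + 1)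
  | left {ρ : Rule P Γ D} {Y Z : Γ} {s q : P} {y : P × Γ × P} {l r b : D} {n m : ℕ}
      (hr : ρ ∈ W.rules) (hw : ρ.word = [Y, Z]) (h₁ : Context W (ρ.dst, Y, s) y l r n)
      (h₂ : Derivation W (s, Z, q) m b) :
      Context W (ρ.src, ρ.top, q) y (ρ.weight * l) (r * b) (n + m + 1)
  | right {ρ : Rule P Γ D} {Y Z : Γ} {s q : P} {y : P × Γ × P} {l r a : D} {n m : ℕ}
      (hr : ρ ∈ W.rules) (hw : ρ.word = [Y, Z]) (h₁ : Derivation W (ρ.dst, Y, s) n a)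
      (h₂ : Context W (s, Z, q) y l r m) :
      Context W (ρ.src, ρ.top, q) y (ρ.weight * (a * l)) r (n + m + 1)

/-- Serves both to cut a repeated piece out of a tree and to insert it again; the node count makes
the cut tree smaller. -/
theorem Context.plug {W : System P Γ D} {x y : P × Γ × P} {l r a : D} {n m : ℕ}
    (hC : Context W x y l r n) (ha : Derivation W y m a) : Derivation W x (n + m) (l * a * r) := by
  induction hC with
  | refl x => simpa using ha
  | unary hr hw _ ih =>
    have := Derivation.unary hr hw (ih ha)
    simp only [mul_assoc] at this ⊢
    convert this using 1
    omega
  | left hr hw _ hb ih =>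
    have := Derivation.binary hr hw (ih ha) hb
    simp only [mul_assoc] at this ⊢
    convert this using 1
    omega
  | right hr hw hb _ ih =>
    have := Derivation.binary hr hw hb (ih ha)
    simp only [mul_assoc] at this ⊢
    convert this using 1
    omega

/-- A derivation tree for `x` in which some branch repeats a variable. -/
def Pumpable (W : System P Γ D) (x : P × Γ × P) (n : ℕ) (a : D) : Prop :=
  ∃ y l r l' r' b k k' m, Context W x y l r k ∧ Context W y y l' r' k' ∧ 0 < k' ∧
    Derivation W y m b ∧ n = k + k' + m ∧ a = l * (l' * b * r') * r

/-- A derivation tree for `x` with a subtree for a variable in `S`. -/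
def Meets (W : System P Γ D) (S : Finset (P × Γ × P)) (x : P × Γ × P) (n : ℕ) (a : D) : Prop :=
  ∃ y ∈ S, ∃ l r b k m, Context W x y l r k ∧ Derivation W y m b ∧ n = k + m ∧ a = l * b * r

/-- If every context for `z` extends to one for `x`, with the factors `u` and `v` and `j + 1` more
nodes, then a repetition in a derivation tree for `z` gives one in the extended tree for `x`. -/
theorem Pumpable.of_child {W : System P Γ D} {x z : P × Γ × P} {n j : ℕ} {a u v : D}
    (h : Pumpable W z n a)
    (step : ∀ {y l r k}, Context W z y l r k → Context W x y (u * l) (r * v) (k + j + 1)) :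
    Pumpable W x (n + j + 1) (u * a * v) := by
  obtain ⟨y, l, r, l', r', b, k, k', m, h₁, h₂, hk, h₃, rfl, rfl⟩ := h
  exact ⟨y, _, _, l', r', b, _, k', m, step h₁, h₂, hk, h₃, by omega, by simp only [mul_assoc]⟩

/-- A hit on `x` itself repeats the root variable, so the tree is pumpable with an empty outer
context; any other hit lies in `S`. -/
theorem Meets.of_child [DecidableEq (P × Γ × P)] {W : System P Γ D} {S : Finset (P × Γ × P)}
    {x z : P × Γ × P} {n j : ℕ} {a u v : D} (h : Meets W (insert x S) z n a)
    (step : ∀ {y l r k}, Context W z y l r k → Context W x y (u * l) (r * v) (k + j + 1)) :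
    Meets W S x (n + j + 1) (u * a * v) ∨ Pumpable W x (n + j + 1) (u * a * v) := by
  obtain ⟨y, hy, l, r, b, k, m, h₁, h₂, rfl, rfl⟩ := h
  rcases Finset.mem_insert.1 hy with rfl | hy
  · exact .inr ⟨y, 1, 1, _, _, b, 0, _, m, .refl y, step h₁, by omega, h₂, by omega,
      by simp only [mul_assoc, one_mul, mul_one]⟩
  · exact .inl ⟨y, hy, _, _, b, _, m, step h₁, h₂, by omega, by simp only [mul_assoc]⟩

/-! ### Kleene iterates as values of derivation trees -/

variable [DecidableEq P] [Fintype P]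

theorem ruleTerm_mono (r : Rule P Γ D) (q : P) :
    Monotone fun v : P × Γ × P → D => ruleTerm v r q := by
  intro v w h
  rcases hr : r.word with _ | ⟨Y, _ | ⟨Z, _ | ⟨T, t⟩⟩⟩ <;> simp only [ruleTerm, hr, le_refl]
  · exact mul_le_mul_right (h _) _
  · exact mul_le_mul_right (Finset.sum_le_sum fun s _ =>
      mul_le_mul' (h (r.dst, Y, s)) (h (s, Z, q))) _

variable [DecidableEq Γ]

theorem popSystem_mono (W : System P Γ D) : Monotone (popSystem W) := by
  rintro v w h ⟨p, X, q⟩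
  exact Finset.sum_le_sum fun r _ => ruleTerm_mono r q h

theorem ruleTerm_le_popSystem {W : System P Γ D} (v : P × Γ × P → D) {r : Rule P Γ D}
    (hr : r ∈ W.rules) (q : P) : ruleTerm v r q ≤ popSystem W v (r.src, r.top, q) :=
  le_sum_of_mem (fun r => ruleTerm v r q) (by simp [hr])

theorem weight_le_popSystem {W : System P Γ D} (v : P × Γ × P → D) {r : Rule P Γ D}
    (hr : r ∈ W.rules) (hw : r.word = []) : r.weight ≤ popSystem W v (r.src, r.top, r.dst) :=
  le_trans (by simp [ruleTerm, hw]) (ruleTerm_le_popSystem v hr _)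

theorem weight_mul_le_popSystem {W : System P Γ D} {v : P × Γ × P → D} {r : Rule P Γ D} {Y : Γ}
    {q : P} {a : D} (hr : r ∈ W.rules) (hw : r.word = [Y]) (ha : a ≤ v (r.dst, Y, q)) :
    r.weight * a ≤ popSystem W v (r.src, r.top, q) :=
  le_trans (by simpa [ruleTerm, hw] using mul_le_mul_right ha _) (ruleTerm_le_popSystem v hr _)

theorem weight_mul_mul_le_popSystem {W : System P Γ D} {v : P × Γ × P → D} {r : Rule P Γ D}
    {Y Z : Γ} {s q : P} {a b : D} (hr : r ∈ W.rules) (hw : r.word = [Y, Z])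
    (ha : a ≤ v (r.dst, Y, s)) (hb : b ≤ v (s, Z, q)) :
    r.weight * (a * b) ≤ popSystem W v (r.src, r.top, q) := by
  refine le_trans ?_ (ruleTerm_le_popSystem v hr _)
  simp only [ruleTerm, hw]
  exact mul_le_mul_right ((mul_le_mul' ha hb).trans
    (le_sum_of_mem (fun s => v (r.dst, Y, s) * v (s, Z, q)) (Finset.mem_univ s))) _

/-- The height of the tree serves as index; monotonicity brings two subtrees to a common one. -/
theorem Derivation.exists_le_kleene {W : System P Γ D} {x : P × Γ × P} {n : ℕ} {a : D}
    (h : Derivation W x n a) : ∃ k, a ≤ kleene (popSystem W) k x := by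
  induction h with
  | leaf hr hw => exact ⟨1, weight_le_popSystem _ hr hw⟩
  | unary hr hw _ ih =>
    obtain ⟨k, hk⟩ := ih
    exact ⟨k + 1, weight_mul_le_popSystem hr hw hk⟩
  | binary hr hw _ _ ih₁ ih₂ =>
    obtain ⟨k, hk⟩ := ih₁
    obtain ⟨j, hj⟩ := ih₂
    have hm := kleene_mono (popSystem_mono W)
    exact ⟨max k j + 1, weight_mul_mul_le_popSystem hr hw (hk.trans (hm (le_max_left k j) _))
      (hj.trans (hm (le_max_right k j) _))⟩

/-- Every nonzero Kleene iterate is the value of a derivation tree. -/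
theorem kleene_eq_zero_or_derivation (htotal : IsTotallyOrdered D) (W : System P Γ D) (k : ℕ)
    (x : P × Γ × P) :
    kleene (popSystem W) k x = 0 ∨ ∃ n, Derivation W x n (kleene (popSystem W) k x) := by
  induction k generalizing x with
  | zero => exact .inl rfl
  | succ k ih =>
    obtain ⟨p, X, q⟩ := x
    simp only [kleene, popSystem]
    generalize kleene (popSystem W) k = v at ih ⊢
    -- The term attaining the sum over rules gives the root of the tree; for a two-symbol word, the
    -- sum over `s` likewise gives the intermediate state.
    rcases htotal.sum_eq_zero_or_exists (W.rules.filter fun r => r.src = p ∧ r.top = X)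
      (fun r => ruleTerm v r q) with h | ⟨r, hr, h⟩
    · exact .inl h
    rw [h]
    obtain ⟨hmem, rfl, rfl⟩ := Finset.mem_filter.1 hr
    rcases hw : r.word with _ | ⟨Y, _ | ⟨Z, _ | ⟨T, t⟩⟩⟩ <;> simp only [ruleTerm, hw]
    · split_ifs with hq
      · subst hq
        exact .inr ⟨1, .leaf hmem hw⟩
      · exact .inl rfl
    · rcases ih (r.dst, Y, q) with h₀ | ⟨n, hn⟩
      · exact .inl (by rw [h₀, mul_zero])
      · exact .inr ⟨_, .unary hmem hw hn⟩
    · rcases htotal.sum_eq_zero_or_exists Finset.univ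
        (fun s => v (r.dst, Y, s) * v (s, Z, q)) with h | ⟨s, -, h⟩
      · exact .inl (by rw [h, mul_zero])
      rw [h]
      rcases ih (r.dst, Y, s) with h₀ | ⟨n, hn⟩
      · exact .inl (by rw [h₀, zero_mul, mul_zero])
      rcases ih (s, Z, q) with h₀ | ⟨m, hm⟩
      · exact .inl (by rw [h₀, mul_zero, mul_zero])
      · exact .inr ⟨_, .binary hmem hw hn hm⟩
    · exact .inl trivial

/-- A derivation tree is bounded by the Kleene iterate whose index is the number of variables
outside `S`, unless one of its branches visits `S` or repeats a variable. -/
theorem Derivation.le_kleene_or_meets_or_pumpable [Fintype Γ] {W : System P Γ D}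
    {x : P × Γ × P} {n : ℕ} {a : D} (h : Derivation W x n a) (S : Finset (P × Γ × P)) :
    a ≤ kleene (popSystem W) Sᶜ.card x ∨ Meets W S x n a ∨ Pumpable W x n a := by
  induction h generalizing S with
  | @leaf r hr hw =>
    by_cases hx : (r.src, r.top, r.dst) ∈ S
    · exact .inr (.inl ⟨_, hx, 1, 1, _, 0, _, .refl _, .leaf hr hw, by simp, by simp⟩)
    -- The root variable lies outside `S`, so the index is at least 1, which suffices for a leaf.
    · obtain ⟨k, hk⟩ := Nat.exists_eq_succ_of_ne_zero
        (Finset.card_ne_zero_of_mem (Finset.mem_compl.2 hx))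
      rw [hk]
      exact .inl (weight_le_popSystem _ hr hw)
  | @unary r Y q n a hr hw h ih =>
    by_cases hx : (r.src, r.top, q) ∈ S
    · exact .inr (.inl ⟨_, hx, 1, 1, _, 0, _, .refl _, .unary hr hw h, by simp, by simp⟩)
    -- Adding the root variable to `S` lowers the index by one, matching the one Kleene step from
    -- child to root.
    have hcard : Sᶜ.card = (insert (r.src, r.top, q) S)ᶜ.card + 1 := by
      rw [Finset.compl_insert, Finset.card_erase_add_one (Finset.mem_compl.2 hx)]
    have step : ∀ {y l ρ k}, Context W (r.dst, Y, q) y l ρ k →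
        Context W (r.src, r.top, q) y (r.weight * l) (ρ * 1) (k + 0 + 1) := fun hC => by
      rw [mul_one]; exact .unary hr hw hC
    rcases ih (insert (r.src, r.top, q) S) with h' | h' | h'
    · rw [hcard]
      exact .inl (weight_mul_le_popSystem hr hw h')
    · simpa using Or.inr (h'.of_child (j := 0) (v := 1) step)
    · simpa using Or.inr (Or.inr (h'.of_child (j := 0) (v := 1) step))
  | @binary r Y Z s q n m a b hr hw h₁ h₂ ih₁ ih₂ =>
    by_cases hx : (r.src, r.top, q) ∈ S
    · exact .inr (.inl ⟨_, hx, 1, 1, _, 0, _, .refl _, .binary hr hw h₁ h₂, by simp, by simp⟩)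
    have hcard : Sᶜ.card = (insert (r.src, r.top, q) S)ᶜ.card + 1 := by
      rw [Finset.compl_insert, Finset.card_erase_add_one (Finset.mem_compl.2 hx)]
    have step₁ : ∀ {y l ρ k}, Context W (r.dst, Y, s) y l ρ k →
        Context W (r.src, r.top, q) y (r.weight * l) (ρ * b) (k + m + 1) := fun hC =>
      .left hr hw hC h₂
    have step₂ : ∀ {y l ρ k}, Context W (s, Z, q) y l ρ k →
        Context W (r.src, r.top, q) y (r.weight * a * l) (ρ * 1) (k + n + 1) := fun hC => by
      rw [mul_one, mul_assoc, add_comm _ n]; exact .right hr hw h₁ hC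
    have e₁ : r.weight * (a * b) = r.weight * a * b := (mul_assoc _ _ _).symm
    have e₂ : r.weight * (a * b) = r.weight * a * b * 1 := by rw [mul_one, e₁]
    have en : n + m + 1 = m + n + 1 := by omega
    rcases ih₁ (insert (r.src, r.top, q) S) with h' | h' | h'
    · rcases ih₂ (insert (r.src, r.top, q) S) with h'' | h'' | h''
      · rw [hcard]
        exact .inl (weight_mul_mul_le_popSystem hr hw h' h'')
      · rw [e₂, en]
        exact .inr (h''.of_child step₂)
      · rw [e₂, en]
        exact .inr (.inr (h''.of_child step₂))
    · rw [e₁]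
      exact .inr (h'.of_child step₁)
    · rw [e₁]
      exact .inr (.inr (h'.of_child step₁))

/-- A component that still changes after as many steps as there are variables never stabilizes. -/
theorem isWitnessComponent_of_kleene_ne [Fintype Γ] (htotal : IsTotallyOrdered D)
    (hextend : ExtendPreservesInequality D) (W : System P Γ D) {i : P × Γ × P}
    (hi : kleene (popSystem W) (Fintype.card (P × Γ × P) + 1) i ≠
      kleene (popSystem W) (Fintype.card (P × Γ × P)) i) :
    IsWitnessComponent (popSystem W) i := by
  by_contra hfin
  obtain ⟨K, hK⟩ := exists_forall_kleene_le (popSystem_mono W) hfin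
  have hbound : ∀ {n a}, Derivation W i n a → a ≤ kleene (popSystem W) K i := fun h =>
    let ⟨k, hk⟩ := h.exists_le_kleene
    hk.trans (hK k)
  have hlt : kleene (popSystem W) (Fintype.card (P × Γ × P)) i < kleene (popSystem W) K i :=
    (lt_of_le_of_ne (kleene_mono (popSystem_mono W) (Nat.le_succ _) i) hi.symm).trans_le (hK _)
  have hM : kleene (popSystem W) K i ≠ 0 := (zero_le.trans_lt hlt).ne'
  have hex := (kleene_eq_zero_or_derivation htotal W K i).resolve_left hM
  generalize kleene (popSystem W) K i = M at hbound hlt hM hex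
  classical
  -- Among the trees for `i` of value `M`, take one with the fewest nodes.
  have hmin := fun m => Nat.find_min (m := m) hex
  have hspec := Nat.find_spec hex
  generalize Nat.find hex = n at hmin hspec
  -- With `S = ∅` the index is the number of variables, and that iterate lies below `M`.
  rcases hspec.le_kleene_or_meets_or_pumpable ∅ with h | ⟨y, hy, -⟩ | h
  · rw [Finset.compl_empty, Finset.card_univ] at h
    exact hlt.not_ge h
  · simp at hy
  obtain ⟨y, l, r, l', r', b, k, k', m, h₁, h₂, hk, h₃, rfl, rfl⟩ := h
  have hshort := h₁.plug h₃
  have hb : b < l' * b * r' := by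
    -- Otherwise cutting out the repeated piece leaves a smaller tree that still has value `M`.
    have hnot : ¬ l' * b * r' ≤ b := fun hle =>
      hmin (k + m) (by omega) (le_antisymm (mul_le_mul_left (mul_le_mul_right hle l) r)
        (hbound hshort) ▸ hshort)
    exact lt_of_le_not_ge ((htotal.le_total _ _).resolve_right hnot) hnot
  exact (hextend.pump_lt hb hM).not_ge (hbound (h₁.plug (h₂.plug (h₂.plug h₃))))

end PopSystem

/-! ### Paths and fixed points of the configuration system -/

theorem Path.append {P Γ D : Type*} {W : System P Γ D} {c c' c'' : Config P Γ} {σ τ : List (Rule P Γ D)}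
    (h : Path W c σ c') (h' : Path W c' τ c'') : Path W c (σ ++ τ) c'' := by
  induction h with
  | nil => exact h'
  | cons hm _ ih => exact .cons hm (ih h')

section Configurations

variable {P Γ D : Type*} [IdemSemiring D]

theorem weight_append (σ τ : List (Rule P Γ D)) : weight (σ ++ τ) = weight σ * weight τ := by
  simp [weight]

/-- A derivation tree for `[pXq]` yields a path that pops `X` off any stack. -/
theorem Derivation.exists_path {W : System P Γ D} {x : P × Γ × P} {n : ℕ} {a : D}
    (h : Derivation W x n a) (γ : List Γ) :
    ∃ σ, Path W (x.1, x.2.1 :: γ) σ (x.2.2, γ) ∧ weight σ = a := by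
  induction h generalizing γ with
  | @leaf r hr hw =>
    exact ⟨[r], .cons ⟨hr, γ, rfl, by simp [hw]⟩ (.nil _), by simp [weight]⟩
  | @unary r Y q n a hr hw _ ih =>
    obtain ⟨σ, hσ, rfl⟩ := ih γ
    exact ⟨r :: σ, .cons ⟨hr, γ, rfl, by simp [hw]⟩ hσ, by simp [weight]⟩
  | @binary r Y Z s q n m a b hr hw _ _ ih₁ ih₂ =>
    obtain ⟨σ, hσ, rfl⟩ := ih₁ (Z :: γ)
    obtain ⟨τ, hτ, rfl⟩ := ih₂ γ
    exact ⟨r :: (σ ++ τ), .cons ⟨hr, γ, rfl, by simp [hw]⟩ (hσ.append hτ), by simp [weight]⟩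

variable [DecidableEq P]

/-- Each move of the path selects one summand of an equation. The target is a variable `c'` so that
induction on the path applies. -/
theorem weight_le_of_configSystem_fixed [DecidableEq Γ] {W : System P Γ D} {pf : P}
    {v : Config P Γ → D}
    (hv : configSystem W pf v = v) {c c' : Config P Γ} {σ : List (Rule P Γ D)}
    (h : Path W c σ c') (hc' : c' = (pf, [])) : weight σ ≤ v c := by
  induction h with
  | nil c => rw [← hv, hc']; simp [configSystem, weight]
  | @cons c c' c'' r σ hm _ ih =>
    obtain ⟨hr, γ, rfl, rfl⟩ := hm
    rw [← hv]
    calc weight (r :: σ) = r.weight * weight σ := by simp [weight]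
      _ ≤ r.weight * v (r.dst, r.word ++ γ) := mul_le_mul_right (ih hc') _
      _ ≤ _ := le_sum_of_mem (fun r : Rule P Γ D => r.weight * v (r.dst, r.word ++ γ)) (by simp [hr])

variable [Fintype P]

theorem combinePops_nil (pf : P) (l : P × Γ × P → D) (p : P) :
    combinePops pf l (p, []) = if p = pf then 1 else 0 := by
  simp only [combinePops, Finset.sum_filter]
  refine (Fintype.sum_equiv (Equiv.funUnique (Fin 1) P) _
    (fun q => if q = p ∧ q = pf then (1 : D) else 0) fun s => ?_).trans ?_
  · rfl
  · simp [ite_and]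

/-- With `combinePops_nil` this gives a recursion on the stack, replacing sums over state sequences.
-/
theorem combinePops_cons (pf : P) (l : P × Γ × P → D) (p : P) (X : Γ) (γ : List Γ) :
    combinePops pf l (p, X :: γ) = ∑ q, l (p, X, q) * combinePops pf l (q, γ) := by
  have h : combinePops pf l (p, X :: γ) =
      ∑ t : Fin (γ.length + 1) → P, if t (Fin.last _) = pf then
        l (p, X, t 0) * (List.ofFn fun i : Fin γ.length =>
          l (t i.castSucc, γ.get i, t i.succ)).prod else 0 := by
    simp only [combinePops, Finset.sum_filter]
    refine (Fintype.sum_equiv (Fin.consEquiv fun _ : Fin (γ.length + 1 + 1) => P)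
      (fun z => if z.1 = p ∧ z.2 (Fin.last _) = pf then
        l (z.1, X, z.2 0) * (List.ofFn fun i : Fin γ.length =>
          l (z.2 i.castSucc, γ.get i, z.2 i.succ)).prod else 0) _ ?_).symm.trans ?_
    · rintro ⟨q, t⟩
      simp only [List.length_cons, List.ofFn_succ, List.prod_cons]
      rfl
    · rw [Fintype.sum_prod_type]
      simp [ite_and]
  rw [h]
  simp only [combinePops, Finset.sum_filter, Finset.mul_sum]
  change _ = ∑ q, ∑ t : Fin (γ.length + 1) → P, l (p, X, q) *
    if t 0 = q ∧ t (Fin.last γ.length) = pf then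
      (List.ofFn fun i : Fin γ.length => l (t i.castSucc, γ.get i, t i.succ)).prod else 0
  -- For a fixed sequence `t`, only `q = t 0` contributes.
  rw [Finset.sum_comm]
  refine Finset.sum_congr rfl fun t _ => ?_
  simp [ite_and]

/-- Distributivity, rule by rule. The length bound is needed because `ruleTerm` is `0` on longer
words. -/
theorem sum_ruleTerm_mul_combinePops (pf : P) (l : P × Γ × P → D) (r : Rule P Γ D)
    (hr : r.word.length ≤ 2) (γ : List Γ) :
    ∑ q, ruleTerm l r q * combinePops pf l (q, γ) =
      r.weight * combinePops pf l (r.dst, r.word ++ γ) := by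
  rcases hw : r.word with _ | ⟨Y, _ | ⟨Z, _ | ⟨T, t⟩⟩⟩
  · simp [ruleTerm, hw]
  · simp [ruleTerm, hw, combinePops_cons, Finset.mul_sum, mul_assoc]
  · simp only [ruleTerm, hw, List.cons_append, List.nil_append, combinePops_cons, Finset.mul_sum,
      Finset.sum_mul, mul_assoc]
    exact Finset.sum_comm
  · simp [hw] at hr

variable [DecidableEq Γ]

/-- A fixed point of the pop system induces a fixed point of the configuration system. -/
theorem configSystem_combinePops {W : System P Γ D} (hW : ∀ r ∈ W.rules, r.word.length ≤ 2)
    (pf : P) {l : P × Γ × P → D} (hl : popSystem W l = l) :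
    configSystem W pf (combinePops pf l) = combinePops pf l := by
  ext ⟨p, _ | ⟨X, γ⟩⟩
  · rw [combinePops_nil]
    rfl
  · calc configSystem W pf (combinePops pf l) (p, X :: γ)
        = ∑ r ∈ W.rules with r.src = p ∧ r.top = X,
            ∑ q, ruleTerm l r q * combinePops pf l (q, γ) :=
          Finset.sum_congr rfl fun r hr =>
            (sum_ruleTerm_mul_combinePops pf l r (hW r (Finset.mem_filter.1 hr).1) γ).symm
      _ = ∑ q, popSystem W l (p, X, q) * combinePops pf l (q, γ) := by
          rw [Finset.sum_comm]
          simp only [popSystem, Finset.sum_mul]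
      _ = combinePops pf l (p, X :: γ) := by rw [hl, combinePops_cons]

/-- The vector built from a Kleene iterate of the pop system is attained by paths. -/
theorem combinePops_kleene_eq_zero_or_path (htotal : IsTotallyOrdered D) (W : System P Γ D)
    (pf : P) (k : ℕ) (p : P) (γ : List Γ) :
    combinePops pf (kleene (popSystem W) k) (p, γ) = 0 ∨
      combinePops pf (kleene (popSystem W) k) (p, γ) ∈ pathWeights W pf (p, γ) := by
  induction γ generalizing p with
  | nil =>
    rw [combinePops_nil]
    split_ifs with hp
    · subst hp
      exact .inr ⟨[], .nil _, rfl⟩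
    · exact .inl rfl
  | cons X γ ih =>
    rw [combinePops_cons]
    rcases htotal.sum_eq_zero_or_exists Finset.univ fun q =>
      kleene (popSystem W) k (p, X, q) * combinePops pf (kleene (popSystem W) k) (q, γ)
      with h | ⟨q, -, h⟩
    · exact .inl h
    rw [h]
    rcases kleene_eq_zero_or_derivation htotal W k (p, X, q) with h₀ | ⟨n, hn⟩
    · exact .inl (by rw [h₀, zero_mul])
    rcases ih q with h₀ | ⟨τ, hτ, hτw⟩
    · exact .inl (by rw [h₀, mul_zero])
    obtain ⟨σ, hσ, hσw⟩ := hn.exists_path γ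
    exact .inr ⟨σ ++ τ, hσ.append hτ, by rw [weight_append, hσw, hτw]⟩

end Configurations

end WPDS

theorem theorem2 {P Γ D : Type*} [Fintype P] [DecidableEq P] [Fintype Γ] [DecidableEq Γ]
    [IdemSemiring D] (htotal : WPDS.IsTotallyOrdered D)
    (hextend : WPDS.ExtendPreservesInequality D)
    (W : WPDS.System P Γ D) (hW : ∀ r ∈ W.rules, r.word.length ≤ 2) (pf : P) :
    (∃ o, WPDS.SafeKleene (WPDS.popSystem W) o) ∧
    (∀ i, WPDS.SafeKleene (WPDS.popSystem W) (WPDS.Answer.witness i) →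
      WPDS.IsWitnessComponent (WPDS.popSystem W) i) ∧
    (∀ l, WPDS.SafeKleene (WPDS.popSystem W) (WPDS.Answer.fixedPoint l) →
      WPDS.IsGreatestFixedPoint (WPDS.popSystem W) l ∧
      WPDS.IsGreatestFixedPoint (WPDS.configSystem W pf) (WPDS.combinePops pf l) ∧
      ∀ c, WPDS.IsMeet (WPDS.pathWeights W pf c) (WPDS.combinePops pf l c)) := by
  refine ⟨?_, ?_, ?_⟩
  · by_cases h : ∃ i, WPDS.kleene (WPDS.popSystem W) (Fintype.card (P × Γ × P) + 1) i ≠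
      WPDS.kleene (WPDS.popSystem W) (Fintype.card (P × Γ × P)) i
    · exact ⟨_, .witness h.choose h.choose_spec⟩
    · exact ⟨_, .fixedPoint h⟩
  · rintro i ⟨⟩
    exact WPDS.isWitnessComponent_of_kleene_ne htotal hextend W ‹_›
  · rintro l ⟨⟩
    rename_i h
    have hfix : WPDS.popSystem W (WPDS.kleene (WPDS.popSystem W) (Fintype.card (P × Γ × P))) =
        WPDS.kleene (WPDS.popSystem W) (Fintype.card (P × Γ × P)) :=
      funext fun i => not_not.1 fun hi => h ⟨i, hi⟩
    have hμ := WPDS.configSystem_combinePops hW pf hfix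
    have hmeet : ∀ c, WPDS.IsMeet (WPDS.pathWeights W pf c)
        (WPDS.combinePops pf (WPDS.kleene (WPDS.popSystem W) (Fintype.card (P × Γ × P))) c) := by
      refine fun c => ⟨?_, fun b hb => WPDS.below_iff_le.2 ?_⟩
      · rintro _ ⟨σ, hσ, rfl⟩
        exact WPDS.below_iff_le.2 (WPDS.weight_le_of_configSystem_fixed hμ hσ rfl)
      -- A nonzero entry is itself a path weight, so every bound on the weights applies to it.
      · rcases WPDS.combinePops_kleene_eq_zero_or_path htotal W pf _ c.1 c.2 with h₀ | h₀
        · exact h₀.trans_le zero_le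
        · exact WPDS.below_iff_le.1 (hb _ h₀)
    refine ⟨⟨hfix, fun v hv i => WPDS.below_iff_le.2 ?_⟩, ⟨hμ, fun v hv c => ?_⟩, hmeet⟩
    · exact WPDS.kleene_le_of_fixed (WPDS.popSystem_mono W) hv _ i
    -- Any fixed point bounds all path weights, hence also their meet.
    · refine (hmeet c).2 _ ?_
      rintro _ ⟨σ, hσ, rfl⟩
      exact WPDS.below_iff_le.2 (WPDS.weight_le_of_configSystem_fixed hv hσ rfl)
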